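/- For a field $\mathbb F$ and integers $d,k,n\ge 0$, let $\mathrm{Pol}_{\le d}(\mathbb F^n,\mathbb F^k)$ be the space of $k$-tuples $\phi=(f_1,\dots,f_k)$ of polynomials $f_j\in\mathbb F[x_1,\dots,x_n]$ of total degree at most $d$, and let $\mathrm{Pol}_{\le d}(\mathbb F^\infty,\mathbb F^k)=\bigcup_{n\in\mathbb N}\mathrm{Pol}_{\le d}(\mathbb F^n,\mathbb F^k)$, where a polynomial in $x_1,\dots,x_n$ is also regarded as a polynomial in more variables. For a set $I\subseteq\mathbb N$, the coordinate restriction $\phi_{|I}$ is obtained from $\phi$ by substituting $0$ for every variable $x_i$ with $i\notin I$. A function $\mathrm{rank}:\mathrm{Pol}_{\le d}(\mathbb F^\infty,\mathbb F^k)\to\mathbb R_{\ge 0}$ is called a natural rank function if $\mathrm{rank}(0)=0$ and, for all $\phi,\gamma\in\mathrm{Pol}_{\le d}(\mathbb F^\infty,\mathbb F^k)$ and all sets $I,J\subseteq\mathbb N$: (1) $\mathrm{rank}(\phi)=\mathrm{rank}(-\phi)$; (2) $\mathrm{rank}(\phi+\gamma)\le\mathrm{rank}(\phi)+\mathrm{rank}(\gamma)$;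 (3) $\mathrm{rank}(\phi_{|I})\le\mathrm{rank}(\phi)$; (4) $\mathrm{rank}(\phi_{|I\cup J})\le\mathrm{rank}(\phi_{|I})+|J|$. Write $I\sim[n]_\sigma$ for a random subset of $[n]=\{1,\dots,n\}$ that contains each element independently with probability $\sigma$. **Theorem.** For every $d\in\mathbb N$ and $\sigma,\varepsilon\in(0,1]$ there exist constants $\kappa=\kappa(d,\sigma)>0$ and $R=R(d,\sigma,\varepsilon)\in\mathbb N$ such that the following holds. For every field $\mathbb F$, all $k,n\in\mathbb N$, every natural rank function $\mathrm{rank}:\mathrm{Pol}_{\le d}(\mathbb F^\infty,\mathbb F^k)\to\mathbb R_{\ge 0}$ and every $\phi\in\mathrm{Pol}_{\le d}(\mathbb F^n,\mathbb F^k)$ with $\mathrm{rank}(\phi)\ge R$, we have $$\Pr_{I\sim[n]_\sigma}\big[\mathrm{rank}(\phi_{|I})\ge\kappa\cdot\mathrm{rank}(\phi)\big]\ge 1-\varepsilon .$$ -/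

import Mathlib

open ProbabilityTheory
open scoped NNReal

universe u

/-- Formal polynomials in the variables `x_0, x_1, x_2, …` restricted to the coordinates in `I`:
every variable outside `I` is replaced by `0`. -/
noncomputable def restrictPoly {F : Type u} [Field F] (I : Set ℕ) :
    MvPolynomial ℕ F →ₐ[F] MvPolynomial ℕ F := by
  classical
  exact MvPolynomial.aeval (fun i => if i ∈ I then MvPolynomial.X i else 0)

theorem totalDegree_restrictPoly_le {F : Type u} [Field F] (I : Set ℕ) (p : MvPolynomial ℕ F) :
    (restrictPoly I p).totalDegree ≤ p.totalDegree := by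
  classical
  unfold restrictPoly
  rw [MvPolynomial.aeval_def, MvPolynomial.eval₂_eq]
  refine MvPolynomial.totalDegree_finsetSum_le fun m hm => ?_
  refine le_trans ?_ (MvPolynomial.le_totalDegree hm)
  refine (MvPolynomial.totalDegree_mul _ _).trans ?_
  rw [MvPolynomial.algebraMap_eq, MvPolynomial.totalDegree_C, zero_add]
  refine (MvPolynomial.totalDegree_finsetProd _ _).trans (Finset.sum_le_sum fun i _ => ?_)
  refine (MvPolynomial.totalDegree_pow _ _).trans ?_
  split_ifs <;> simp

/-- The space `Pol_{≤ d}(F^∞, F^k)`: ordered `k`-tuples of polynomials of degree at most `d` over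
`F`, each involving finitely many of the variables `x_0, x_1, x_2, …`. This is the union over `n` of
the spaces `Pol_{≤ d}(F^n, F^k)`, where a polynomial in `x_0, …, x_{n-1}` is identified with the
same polynomial regarded as one in more variables. -/
noncomputable def PolMap (F : Type u) [Field F] (d k : ℕ) : Submodule F (Fin k → MvPolynomial ℕ F) :=
  Submodule.pi Set.univ fun _ => MvPolynomial.restrictTotalDegree ℕ F d

namespace PolMap

/-- The subspace `Pol_{≤ d}(F^n, F^k)` of `Pol_{≤ d}(F^∞, F^k)`: the maps whose components involve
only the variables `x_0, …, x_{n-1}`. -/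
def InVars {F : Type u} [Field F] {d k : ℕ} (n : ℕ) (φ : PolMap F d k) : Prop :=
  ∀ j, φ.1 j ∈ MvPolynomial.supported F (Set.Iio n)

/-- The coordinate restriction `φ_{|I}`, for which `φ_{|I}(y) = φ(ȳ)`, with `ȳ` equal to `y` on `I`
and to `0` elsewhere. -/
noncomputable def restrict {F : Type u} [Field F] {d k : ℕ} (φ : PolMap F d k) (I : Set ℕ) :
    PolMap F d k :=
  ⟨fun j => restrictPoly I (φ.1 j), fun j hj =>
    (MvPolynomial.mem_restrictTotalDegree _ _ _).2 ((totalDegree_restrictPoly_le I _).trans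
      ((MvPolynomial.mem_restrictTotalDegree _ _ _).1 (φ.2 j hj)))⟩

end PolMap

/-- Natural rank functions on `Pol_{≤ d}(F^∞, F^k)`. In the Lipschitz property the set `J` may be
taken finite, as there is nothing to require when `|J| = ∞`. -/
structure IsNaturalRank {F : Type u} [Field F] {d k : ℕ} (rank : PolMap F d k → ℝ≥0) : Prop where
  map_zero : rank 0 = 0
  symmetric : ∀ φ, rank φ = rank (-φ)
  subadditive : ∀ φ γ, rank (φ + γ) ≤ rank φ + rank γ
  monotone : ∀ φ (I : Set ℕ), rank (PolMap.restrict φ I) ≤ rank φ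
  lipschitz : ∀ φ (I : Set ℕ) (J : Finset ℕ),
    rank (PolMap.restrict φ (I ∪ J)) ≤ rank (PolMap.restrict φ I) + J.card

/-!
Fix a natural rank function and `φ` of degree at most `d`, and put `f t = rank (φ_{|t})` for finite
`t`. Only three facts about `f` matter: it is monotone, it grows by at most one when a coordinate is
added, and it loses at most a constant factor *on average* under a random restriction.

The last fact comes from inclusion–exclusion. Colour the coordinates with `d + 1` colours. A
monomial of degree at most `d` misses some colour, so the product over all colours `i` of
`id - (deletion of colour i)` annihilates `φ`. Expanding it bounds `rank φ` by a constant times the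
sum over `i` of the rank of `φ` with colour `i` deleted
(`IsNaturalRank.exists_le_add_sum_restrict`). For a uniformly random colouring, each of these
restrictions keeps every coordinate with probability `d / (d + 1)`, independently; so
`f t ≤ C₀ 𝔼 f(t')` for such a random subset `t'` of `t`. Iterating, the density drops to some
`p₀ < σ` and `f s ≤ C 𝔼_{p₀} f`. In particular `f` is at least `c f(s)` with probability at least
`c = 1 / (2C)`, at every density `p ∈ [p₀, σ]`.

To boost this to probability `1 - ε` without changing the constant, consider the shortfall
`h = max (c f(s) - f) 0`. It is antitone and 1-Lipschitz, so the Efron–Stein inequality and Russo's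
formula combine to `Var_p h ≤ -p (1 - p) · d/dp 𝔼_p h` (`exists_hasDerivAt_variance_le`). On the
other hand, `h` vanishes with probability at least `c`, so `Var_p h ≥ c (𝔼_p h)²`
(`mul_sq_le_variance_shortfall`). As `𝔼_p h` lies in `[0, c f(s)]`, the mean value theorem provides
a `p ∈ (p₀, σ)` at which the derivative is at least `-c f(s) / (σ - p₀)`. Hence
`(𝔼_σ h)² ≤ (𝔼_p h)² ≤ f(s) / (σ - p₀)`, so that `𝔼_σ h` is of order `√f(s)`, and Markov's inequality
finishes the proof once `f(s)` is large.
-/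

open Finset

/-! ### Averages over random subsets of a finite set -/

/-- The expectation of `g t`, where `t` is a random subset of the finite set `s` containing each
element independently with probability `p`. It is an explicit finite sum, hence a polynomial in
`p`, and is meaningful as an expectation for `p ∈ [0, 1]`. -/
noncomputable def subsetAvg {α : Type*} [DecidableEq α] (p : ℝ) (s : Finset α)
    (g : Finset α → ℝ) : ℝ :=
  ∑ t ∈ s.powerset, p ^ #t * (1 - p) ^ #(s \ t) * g t

section SubsetAvg

variable {α : Type*} [DecidableEq α]

@[simp] theorem subsetAvg_empty (p : ℝ) (g : Finset α → ℝ) : subsetAvg p ∅ g = g ∅ := by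
  simp [subsetAvg]

/-- Conditioning on whether `a` belongs to the random set. Facts about `subsetAvg` are proved by
induction on `s` from this recursion. -/
theorem subsetAvg_insert (p : ℝ) {a : α} {s : Finset α} (ha : a ∉ s) (g : Finset α → ℝ) :
    subsetAvg p (insert a s) g =
      (1 - p) * subsetAvg p s g + p * subsetAvg p s fun t => g (insert a t) := by
  unfold subsetAvg
  rw [Finset.sum_powerset_insert ha, Finset.mul_sum, Finset.mul_sum]
  congr 1 <;> refine Finset.sum_congr rfl fun t ht => ?_
  · have hat : a ∉ t := fun h => ha (Finset.mem_powerset.1 ht h)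
    rw [Finset.insert_sdiff_of_notMem _ hat, Finset.card_insert_of_notMem (by simp [ha])]
    ring
  · have hat : a ∉ t := fun h => ha (Finset.mem_powerset.1 ht h)
    rw [Finset.insert_sdiff_insert, Finset.sdiff_insert_of_notMem ha,
      Finset.card_insert_of_notMem hat]
    ring

theorem subsetAvg_congr (p : ℝ) (s : Finset α) {g g' : Finset α → ℝ} (h : ∀ t ⊆ s, g t = g' t) :
    subsetAvg p s g = subsetAvg p s g' :=
  Finset.sum_congr rfl fun t ht => by rw [h t (Finset.mem_powerset.1 ht)]

theorem subsetAvg_add (p : ℝ) (s : Finset α) (g g' : Finset α → ℝ) :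
    subsetAvg p s (fun t => g t + g' t) = subsetAvg p s g + subsetAvg p s g' := by
  simp [subsetAvg, mul_add, Finset.sum_add_distrib]

theorem subsetAvg_const_mul (p c : ℝ) (s : Finset α) (g : Finset α → ℝ) :
    subsetAvg p s (fun t => c * g t) = c * subsetAvg p s g := by
  simp only [subsetAvg, Finset.mul_sum]
  exact Finset.sum_congr rfl fun t _ => by ring

theorem subsetAvg_const (p c : ℝ) (s : Finset α) : subsetAvg p s (fun _ => c) = c := by
  induction s using Finset.induction_on with
  | empty => simp
  | insert a s ha ih => rw [subsetAvg_insert p ha, ih]; ring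

theorem subsetAvg_one (s : Finset α) (g : Finset α → ℝ) : subsetAvg 1 s g = g s := by
  induction s using Finset.induction_on generalizing g with
  | empty => simp
  | insert a s ha ih => rw [subsetAvg_insert 1 ha, ih, ih]; ring

theorem subsetAvg_mono {p : ℝ} (hp₀ : 0 ≤ p) (hp₁ : p ≤ 1) (s : Finset α) {g g' : Finset α → ℝ}
    (h : ∀ t ⊆ s, g t ≤ g' t) : subsetAvg p s g ≤ subsetAvg p s g' :=
  Finset.sum_le_sum fun t ht =>
    mul_le_mul_of_nonneg_left (h t (Finset.mem_powerset.1 ht))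
      (mul_nonneg (pow_nonneg hp₀ _) (pow_nonneg (sub_nonneg.2 hp₁) _))

/-- A random subset of density `q` of a random subset of density `p` is a random subset of density
`p * q`. -/
theorem subsetAvg_subsetAvg (p q : ℝ) (s : Finset α) (g : Finset α → ℝ) :
    subsetAvg p s (fun t => subsetAvg q t g) = subsetAvg (p * q) s g := by
  induction s using Finset.induction_on generalizing g with
  | empty => simp
  | insert a s ha ih =>
    rw [subsetAvg_insert p ha, subsetAvg_insert (p * q) ha]
    have h : subsetAvg p s (fun t => subsetAvg q (insert a t) g) =
        subsetAvg p s fun t => (1 - q) * subsetAvg q t g +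
          q * subsetAvg q t fun t => g (insert a t) :=
      subsetAvg_congr p s fun t ht => subsetAvg_insert q (fun h => ha (ht h)) g
    rw [h, subsetAvg_add, subsetAvg_const_mul, subsetAvg_const_mul, ih, ih]
    ring

theorem subsetAvg_mono_prob {p q : ℝ} (hp : 0 ≤ p) (hpq : p ≤ q) (hq : q ≤ 1) (s : Finset α)
    {g : Finset α → ℝ} (hg : Monotone g) : subsetAvg p s g ≤ subsetAvg q s g := by
  have hq₀ : 0 ≤ q := hp.trans hpq
  have hr : q * (p / q) = p := by
    rcases hq₀.eq_or_lt with h | h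
    · subst h; simp [le_antisymm hpq hp]
    · field_simp
  rw [← hr, ← subsetAvg_subsetAvg]
  refine subsetAvg_mono hq₀ hq s fun t _ => ?_
  calc subsetAvg (p / q) t g ≤ subsetAvg (p / q) t fun _ => g t :=
        subsetAvg_mono (div_nonneg hp hq₀) (div_le_one_of_le₀ hpq hq₀) t fun u hu => hg hu
    _ = g t := subsetAvg_const _ _ _

theorem subsetAvg_anti_prob {p q : ℝ} (hp : 0 ≤ p) (hpq : p ≤ q) (hq : q ≤ 1) (s : Finset α)
    {g : Finset α → ℝ} (hg : Antitone g) : subsetAvg q s g ≤ subsetAvg p s g := by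
  have h := subsetAvg_mono_prob hp hpq hq s (g := fun t => -1 * g t)
    fun t u htu => by linarith [hg htu]
  rw [subsetAvg_const_mul, subsetAvg_const_mul] at h
  linarith

/-- If restricting to a random subset of density `q` costs at most a factor `C` on average, then
restricting to density `q ^ j` costs at most a factor `C ^ j`. -/
theorem le_pow_mul_subsetAvg_pow {q C : ℝ} (hq₀ : 0 ≤ q) (hq₁ : q ≤ 1) (hC : 0 ≤ C)
    {f : Finset α → ℝ} (hf : ∀ t, f t ≤ C * subsetAvg q t f) (j : ℕ) (s : Finset α) :
    f s ≤ C ^ j * subsetAvg (q ^ j) s f := by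
  induction j with
  | zero => simp [subsetAvg_one]
  | succ j ih =>
    refine ih.trans ?_
    rw [pow_succ, pow_succ, mul_assoc, ← subsetAvg_subsetAvg, ← subsetAvg_const_mul _ C]
    exact mul_le_mul_of_nonneg_left
      (subsetAvg_mono (pow_nonneg hq₀ _) (pow_le_one₀ hq₀ hq₁) s fun t _ => hf t) (pow_nonneg hC _)

/-- An inequality valid for all colourings of `s` holds on average over a uniformly random
colouring, under which the set of elements not coloured `i` is a random subset of density
`1 - 1 / #ι`. -/
theorem le_sum_subsetAvg_of_forall_coloring {ι : Type*} [Fintype ι] [DecidableEq ι] [Nonempty ι]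
    (s : Finset α) (c : ℝ) (F : ι → Finset α → ℝ)
    (h : ∀ χ : α → ι, c ≤ ∑ i, F i (s.filter fun x => χ x ≠ i)) :
    c ≤ ∑ i, subsetAvg (1 - 1 / Fintype.card ι) s (F i) := by
  induction s using Finset.induction_on generalizing F with
  | empty => simpa using h fun _ => Classical.arbitrary ι
  | insert a s ha ih =>
    set p : ℝ := 1 - 1 / Fintype.card ι with hp
    have hcard : (Fintype.card ι : ℝ) ≠ 0 := by simp
    -- condition on the colour `j` of `a`
    have key (j : ι) :
        c ≤ ∑ i, subsetAvg p s (if j = i then F i else fun t => F i (insert a t)) := by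
      refine ih _ fun χ => (h (Function.update χ a j)).trans_eq (Finset.sum_congr rfl fun i _ => ?_)
      have hs : (s.filter fun x => Function.update χ a j x ≠ i) = s.filter fun x => χ x ≠ i :=
        Finset.filter_congr fun x hx => by
          rw [Function.update_of_ne (ne_of_mem_of_not_mem hx ha)]
      rw [Finset.filter_insert, hs, Function.update_self]
      split_ifs <;> simp_all
    have hsum := Finset.sum_le_sum fun j (_ : j ∈ Finset.univ) => key j
    rw [Finset.sum_const, Finset.card_univ, nsmul_eq_mul, Finset.sum_comm] at hsum
    have hinner (i : ι) :
        ∑ j, subsetAvg p s (if j = i then F i else fun t => F i (insert a t)) =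
          Fintype.card ι * subsetAvg p (insert a s) (F i) := by
      have h1 (j : ι) : subsetAvg p s (if j = i then F i else fun t => F i (insert a t)) =
          subsetAvg p s (fun t => F i (insert a t)) + if j = i then
            subsetAvg p s (F i) - subsetAvg p s (fun t => F i (insert a t)) else 0 := by
        split_ifs <;> ring
      simp only [h1, Finset.sum_add_distrib, Finset.sum_ite_eq', Finset.mem_univ, if_true,
        Finset.sum_const, Finset.card_univ, nsmul_eq_mul]
      rw [subsetAvg_insert p ha, hp]
      field_simp
      ring
    simp only [hinner, ← Finset.mul_sum] at hsum
    exact le_of_mul_le_mul_left hsum (by positivity)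

/-! ### Variance of Lipschitz functions and concentration -/

/-- The Efron–Stein inequality combined with Russo's formula: for an antitone 1-Lipschitz `h`, the
variance at density `p` is at most `-p (1 - p)` times the derivative of the mean. The increments of
`h` lie in `[0, 1]`, so their squares (Efron–Stein) are at most the increments themselves
(Russo). -/
theorem exists_hasDerivAt_variance_le {p : ℝ} (hp₀ : 0 ≤ p) (hp₁ : p ≤ 1) (s : Finset α)
    (h : Finset α → ℝ) (h_anti : ∀ a t, h (insert a t) ≤ h t)
    (h_lip : ∀ a t, h t ≤ h (insert a t) + 1) :
    ∃ D, HasDerivAt (fun x => subsetAvg x s h) D p ∧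
      subsetAvg p s (fun t => h t ^ 2) - subsetAvg p s h ^ 2 ≤ p * (1 - p) * -D := by
  induction s using Finset.induction_on generalizing h with
  | empty => exact ⟨0, by simpa using hasDerivAt_const p (h ∅), by simp⟩
  | insert a s ha ih =>
    obtain ⟨D₀, hD₀, hV₀⟩ := ih h h_anti h_lip
    obtain ⟨D₁, hD₁, hV₁⟩ := ih (fun t => h (insert a t))
      (fun b t => by rw [Finset.insert_comm]; exact h_anti b _)
      (fun b t => by rw [Finset.insert_comm]; exact h_lip b _)
    refine ⟨_, (((hasDerivAt_id p).const_sub 1).mul hD₀ |>.add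
      ((hasDerivAt_id p).mul hD₁)).congr_of_eventuallyEq
        (.of_forall fun x => subsetAvg_insert x ha h), ?_⟩
    rw [subsetAvg_insert p ha, subsetAvg_insert p ha]
    simp only [id]
    have hle : subsetAvg p s (fun t => h (insert a t)) ≤ subsetAvg p s h :=
      subsetAvg_mono hp₀ hp₁ s fun t _ => h_anti a t
    have hge : subsetAvg p s h ≤ subsetAvg p s (fun t => h (insert a t)) + 1 := by
      rw [← subsetAvg_const p 1 s, ← subsetAvg_add]
      exact subsetAvg_mono hp₀ hp₁ s fun t _ => by simpa only [subsetAvg_const] using h_lip a t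
    set M₀ := subsetAvg p s h
    set M₁ := subsetAvg p s fun t => h (insert a t)
    have h1 := mul_le_mul_of_nonneg_left hV₀ (sub_nonneg.2 hp₁)
    have h2 := mul_le_mul_of_nonneg_left hV₁ hp₀
    have h3 := mul_nonneg (mul_nonneg hp₀ (sub_nonneg.2 hp₁))
      (mul_nonneg (sub_nonneg.2 hle) (by linarith : 0 ≤ 1 - (M₀ - M₁)))
    nlinarith

/-- If `f ≤ r` has mean at least `2 c r`, then the shortfall `max (c r - f) 0` vanishes with
probability at least `c`, so that its variance is at least `c` times the square of its mean. -/
theorem mul_sq_le_variance_shortfall {p c r : ℝ} (hp₀ : 0 ≤ p) (hp₁ : p ≤ 1) (hc : 0 ≤ c)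
    (hr : 0 < r) (s : Finset α) (f : Finset α → ℝ) (hf : ∀ t ⊆ s, f t ≤ r)
    (hmean : 2 * c * r ≤ subsetAvg p s f) :
    c * subsetAvg p s (fun t => max (c * r - f t) 0) ^ 2 ≤
      subsetAvg p s (fun t => max (c * r - f t) 0 ^ 2) -
        subsetAvg p s (fun t => max (c * r - f t) 0) ^ 2 := by
  classical
  set h : Finset α → ℝ := fun t => max (c * r - f t) 0
  set u : Finset α → ℝ := fun t => if f t < c * r then 1 else 0 with hu
  set M := subsetAvg p s h with hM
  set P := subsetAvg p s u with hP
  have hPc : P ≤ 1 - c := by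
    have h1 : subsetAvg p s f ≤ subsetAvg p s fun t => r + (c * r - r) * u t := by
      refine subsetAvg_mono hp₀ hp₁ s fun t ht => ?_
      by_cases hlt : f t < c * r
      · simp only [hu, hlt, if_true]; linarith
      · simp only [hu, hlt, if_false]; linarith [hf t ht]
    rw [subsetAvg_add, subsetAvg_const, subsetAvg_const_mul] at h1
    have hc1 : c * r ≤ r * (1 - P) + c * r * P - c * r := by linarith
    have hP0 : 0 ≤ P := by
      rw [← subsetAvg_const p 0 s]
      exact subsetAvg_mono hp₀ hp₁ s fun t _ => by simp only [hu]; split_ifs <;> norm_num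
    have hP1 : P ≤ 1 := by
      rw [← subsetAvg_const p 1 s]
      exact subsetAvg_mono hp₀ hp₁ s fun t _ => by simp only [hu]; split_ifs <;> norm_num
    have : r * c ≤ r * (1 - P) := by nlinarith [mul_nonneg (mul_nonneg hc hr.le) (sub_nonneg.2 hP1)]
    linarith [le_of_mul_le_mul_left this hr]
  -- Cauchy–Schwarz for `h = h * u`: expand the mean of `(h - l * u) ^ 2 ≥ 0`, with
  -- `l = (1 + c) * M` approximating the optimal value `M / (1 - c)`
  set l := (1 + c) * M
  have hsq : 0 ≤ subsetAvg p s (fun t => h t ^ 2) + -(2 * l) * M + l ^ 2 * P := by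
    rw [hM, hP, ← subsetAvg_const_mul, ← subsetAvg_const_mul, ← subsetAvg_add, ← subsetAvg_add,
      ← subsetAvg_const p 0 s]
    refine subsetAvg_mono hp₀ hp₁ s fun t _ => ?_
    by_cases hlt : f t < c * r
    · simp only [hu, hlt, if_true]; nlinarith [sq_nonneg (h t - l)]
    · have : h t = 0 := max_eq_right (by linarith)
      simp [hu, hlt, this]
  have h1 := mul_le_mul_of_nonneg_left hPc (sq_nonneg l)
  have h2 : 0 ≤ c ^ 2 * (1 + c) * M ^ 2 := by positivity
  simp only [l] at hsq h1
  nlinarith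

/-- A monotone 1-Lipschitz function whose mean at density `p₀` is at least `2 c f(s)` is at least
`c / 2 * f(s)` with probability at least `1 - ε` at any density `σ > p₀`, provided that `f(s)` is
large. -/
theorem one_sub_le_subsetAvg_of_mean_le {p₀ σ c ε : ℝ} (hp₀ : 0 ≤ p₀) (hp₀σ : p₀ < σ) (hσ : σ ≤ 1)
    (hc : 0 < c) (hε : 0 < ε) (s : Finset α) {f : Finset α → ℝ} (hf : Monotone f)
    (hf₀ : ∀ t, 0 ≤ f t) (h_lip : ∀ a t, f (insert a t) ≤ f t + 1)
    (hmean : 2 * c * f s ≤ subsetAvg p₀ s f) (hr : 0 < f s)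
    (hlarge : 4 / (ε ^ 2 * c ^ 2 * (σ - p₀)) ≤ f s) :
    1 - ε ≤ subsetAvg σ s fun t => if c / 2 * f s ≤ f t then 1 else 0 := by
  set r := f s
  set h : Finset α → ℝ := fun t => max (c * r - f t) 0
  have h_anti : Antitone h := fun t u htu => max_le_max (by linarith [hf htu]) le_rfl
  have hσp : 0 < σ - p₀ := sub_pos.2 hp₀σ
  have h_insert (a : α) (t : Finset α) : h t ≤ h (insert a t) + 1 := by
    refine max_le ?_ (by linarith [le_max_right (c * r - f (insert a t)) 0])
    linarith [le_max_left (c * r - f (insert a t)) 0, h_lip a t]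
  have hder (p : ℝ) (h₀ : 0 ≤ p) (h₁ : p ≤ 1) := exists_hasDerivAt_variance_le h₀ h₁ s h
    (fun a t => h_anti (Finset.subset_insert a t)) h_insert
  have hM_nonneg (p : ℝ) (h₀ : 0 ≤ p) (h₁ : p ≤ 1) : 0 ≤ subsetAvg p s h := by
    rw [← subsetAvg_const p 0 s]
    exact subsetAvg_mono h₀ h₁ s fun t _ => le_max_right _ _
  have hM₀ : subsetAvg p₀ s h ≤ c * r := by
    rw [← subsetAvg_const p₀ (c * r) s]
    exact subsetAvg_mono hp₀ (by linarith) s fun t _ =>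
      max_le (by linarith [hf₀ t]) (by positivity)
  have hdiff (p : ℝ) (hp : p ∈ Set.Icc p₀ σ) : DifferentiableAt ℝ (fun x => subsetAvg x s h) p := by
    obtain ⟨D, hD, -⟩ := hder p (hp₀.trans hp.1) (hp.2.trans hσ)
    exact hD.differentiableAt
  obtain ⟨p, hp, hslope⟩ := exists_deriv_eq_slope (fun x => subsetAvg x s h) hp₀σ
    (fun x hx => (hdiff x hx).continuousAt.continuousWithinAt)
    (fun x hx => (hdiff x (Set.Ioo_subset_Icc_self hx)).differentiableWithinAt)
  have hp0 : 0 ≤ p := hp₀.trans hp.1.le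
  have hp1 : p ≤ 1 := hp.2.le.trans hσ
  obtain ⟨D, hD, hV⟩ := hder p hp0 hp1
  rw [hD.deriv] at hslope
  have hMσ := hM_nonneg σ (by linarith) hσ
  have hDle : -D ≤ c * r / (σ - p₀) := by
    rw [hslope, ← neg_div]
    gcongr
    linarith
  have hvar : c * subsetAvg p s h ^ 2 ≤ c * r / (σ - p₀) := by
    have h1 := mul_sq_le_variance_shortfall hp0 hp1 hc.le hr s f (fun t ht => hf ht)
      (hmean.trans (subsetAvg_mono_prob hp₀ hp.1.le hp1 s hf))
    have h2 : p * (1 - p) * -D ≤ p * (1 - p) * (c * r / (σ - p₀)) :=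
      mul_le_mul_of_nonneg_left hDle (mul_nonneg hp0 (sub_nonneg.2 hp1))
    have h3 : p * (1 - p) * (c * r / (σ - p₀)) ≤ 1 * (c * r / (σ - p₀)) :=
      mul_le_mul_of_nonneg_right (by nlinarith) (by positivity)
    linarith
  have hMsq : subsetAvg σ s h ^ 2 ≤ r / (σ - p₀) := by
    have h1 : subsetAvg p s h ^ 2 ≤ r / (σ - p₀) := by
      rw [mul_div_assoc] at hvar
      exact le_of_mul_le_mul_left hvar hc
    exact (pow_le_pow_left₀ hMσ (subsetAvg_anti_prob hp0 hp.2.le hσ s h_anti) 2).trans h1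
  have hM : subsetAvg σ s h ≤ ε * (c * r / 2) := by
    refine le_of_sq_le_sq ?_ (by positivity)
    refine hMsq.trans ?_
    rw [div_le_iff₀ (by positivity)] at hlarge ⊢
    nlinarith
  -- Markov's inequality
  have hmarkov : subsetAvg σ s (fun _ => 1) ≤ subsetAvg σ s fun t =>
      (if c / 2 * r ≤ f t then 1 else 0) + (c * r / 2)⁻¹ * h t := by
    refine subsetAvg_mono (by linarith) hσ s fun t _ => ?_
    have hcr : 0 < c * r / 2 := by positivity
    split_ifs with hle
    · have : 0 ≤ h t := le_max_right _ _
      have : 0 ≤ (c * r / 2)⁻¹ * h t := by positivity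
      linarith
    · rw [zero_add, ← div_eq_inv_mul, le_div_iff₀ hcr]
      refine le_max_of_le_left ?_
      linarith
  rw [subsetAvg_const, subsetAvg_add, subsetAvg_const_mul, ← div_eq_inv_mul] at hmarkov
  have : subsetAvg σ s h / (c * r / 2) ≤ ε := (div_le_iff₀ (by positivity)).2 hM
  linarith

end SubsetAvg

theorem setBernoulli_real_eq_subsetAvg {α : Type*} [DecidableEq α] [Countable α] (p : unitInterval)
    (s : Finset α) (S : Set (Set α)) [∀ t : Finset α, Decidable ((t : Set α) ∈ S)] :
    (setBernoulli (s : Set α) p).real S =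
      subsetAvg (p : ℝ) s fun t => if (t : Set α) ∈ S then 1 else 0 := by
  have hS : {t | t ∈ S ∧ t ⊆ (s : Set α)} =
      ⋃ t ∈ s.powerset.filter (fun t : Finset α => (t : Set α) ∈ S), {(t : Set α)} := by
    ext t
    simp only [Set.mem_ofPred_eq, Set.mem_iUnion, Finset.mem_filter, Finset.mem_powerset,
      Set.mem_singleton_iff, exists_prop]
    constructor
    · rintro ⟨htS, hts⟩
      lift t to Finset α using s.finite_toSet.subset hts
      exact ⟨t, ⟨by exact_mod_cast hts, htS⟩, rfl⟩
    · rintro ⟨t, ⟨hts, htS⟩, rfl⟩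
      exact ⟨htS, by exact_mod_cast hts⟩
  rw [MeasureTheory.measureReal_def, setBernoulli_apply_eq_apply_subsets, hS,
    ← MeasureTheory.measureReal_def,
    MeasureTheory.measureReal_biUnion_finset (by simp [Set.PairwiseDisjoint, Set.Pairwise]) (by simp),
    Finset.sum_filter]
  refine Finset.sum_congr rfl fun t ht => ?_
  have hts : (t : Set α) ⊆ s := by exact_mod_cast Finset.mem_powerset.1 ht
  by_cases htS : (t : Set α) ∈ S
  · simp only [htS, if_true]
    rw [setBernoulli_real_singleton p hts s.finite_toSet, ← Finset.coe_sdiff,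
      Set.ncard_coe_finset, Set.ncard_coe_finset, mul_one]
  · simp [htS]

/-! ### Coordinate restrictions of polynomial maps -/

open Classical in
theorem coeff_restrictPoly {F : Type u} [Field F] (I : Set ℕ) (p : MvPolynomial ℕ F) (m : ℕ →₀ ℕ) :
    (restrictPoly I p).coeff m = if (m.support : Set ℕ) ⊆ I then p.coeff m else 0 := by
  induction p using MvPolynomial.induction_on' with
  | add p q hp hq =>
    rw [map_add, MvPolynomial.coeff_add, hp, hq, MvPolynomial.coeff_add]
    split_ifs <;> simp
  | monomial v c =>
    have h : restrictPoly I (MvPolynomial.monomial v c) =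
        if (v.support : Set ℕ) ⊆ I then MvPolynomial.monomial v c else 0 := by
      unfold restrictPoly
      rw [MvPolynomial.aeval_monomial]
      split_ifs with hv
      · rw [MvPolynomial.monomial_eq, MvPolynomial.algebraMap_eq]
        congr 1
        exact Finsupp.prod_congr fun i hi => by rw [if_pos (hv hi)]
      · obtain ⟨i, hi, hiI⟩ := Set.not_subset.1 hv
        rw [Finsupp.prod, Finset.prod_eq_zero hi, mul_zero]
        rw [if_neg hiI, zero_pow (Finsupp.mem_support_iff.1 hi)]
    rw [h]
    by_cases hvm : v = m
    · subst hvm; split_ifs <;> simp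
    · split_ifs <;> simp [MvPolynomial.coeff_monomial, hvm]

namespace PolMap

variable {F : Type u} [Field F] {d k : ℕ}

theorem ext_coeff {φ γ : PolMap F d k} (h : ∀ j m, (φ.1 j).coeff m = (γ.1 j).coeff m) : φ = γ :=
  Subtype.ext <| funext fun j => MvPolynomial.ext _ _ (h j)

open Classical in
theorem coeff_restrict (φ : PolMap F d k) (I : Set ℕ) (j : Fin k) (m : ℕ →₀ ℕ) :
    ((restrict φ I).1 j).coeff m = if (m.support : Set ℕ) ⊆ I then (φ.1 j).coeff m else 0 :=
  coeff_restrictPoly I (φ.1 j) m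

theorem restrict_sub (φ γ : PolMap F d k) (I : Set ℕ) :
    restrict (φ - γ) I = restrict φ I - restrict γ I :=
  Subtype.ext <| funext fun j => map_sub (restrictPoly I) (φ.1 j) (γ.1 j)

theorem restrict_restrict (φ : PolMap F d k) (I J : Set ℕ) :
    restrict (restrict φ I) J = restrict φ (I ∩ J) := by
  classical
  refine ext_coeff fun j m => ?_
  simp only [coeff_restrict, Set.subset_inter_iff]
  split_ifs <;> simp_all

theorem InVars.restrict_eq {n : ℕ} {φ : PolMap F d k} (h : InVars n φ) :
    restrict φ (Set.Iio n) = φ := by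
  classical
  refine ext_coeff fun j m => ?_
  rw [coeff_restrict]
  split_ifs with hm
  · rfl
  · by_contra hne
    refine hm fun i hi => (MvPolynomial.mem_supported.1 (h j)) ?_
    exact MvPolynomial.mem_vars_iff_mem_support _ |>.2
      ⟨m, MvPolynomial.mem_support_iff.2 (Ne.symm hne), hi⟩

/-- A monomial of degree at most `d` misses one of any `d + 1` colours. -/
theorem exists_support_subset_of_coeff_ne_zero (φ : PolMap F d k) {j : Fin k} {m : ℕ →₀ ℕ}
    (hm : (φ.1 j).coeff m ≠ 0) (χ : ℕ → Fin (d + 1)) :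
    ∃ i, (m.support : Set ℕ) ⊆ {x | χ x ≠ i} := by
  by_contra! h
  have hsurj : m.support.image χ = Finset.univ := by
    refine Finset.eq_univ_of_forall fun i => ?_
    obtain ⟨x, hx, hxi⟩ := Set.not_subset.1 (h i)
    exact Finset.mem_image.2 ⟨x, hx, not_not.1 hxi⟩
  have h1 : d + 1 ≤ #m.support := by
    simpa [hsurj] using Finset.card_image_le (s := m.support) (f := χ)
  have h2 : #m.support ≤ m.sum fun _ e => e := by
    rw [Finset.card_eq_sum_ones]
    exact Finset.sum_le_sum fun i hi => Nat.one_le_iff_ne_zero.2 (Finsupp.mem_support_iff.1 hi)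
  have h3 := MvPolynomial.le_totalDegree (MvPolynomial.mem_support_iff.2 hm)
  have h4 : (φ.1 j).totalDegree ≤ d :=
    (MvPolynomial.mem_restrictTotalDegree _ _ _).1 (φ.2 j (Set.mem_univ j))
  omega

end PolMap

/-! ### Ranks of random restrictions -/

namespace IsNaturalRank

open PolMap

variable {F : Type u} [Field F] {d k : ℕ} {rank : PolMap F d k → ℝ≥0}

theorem sub_le (h : IsNaturalRank rank) (φ γ : PolMap F d k) :
    rank (φ - γ) ≤ rank φ + rank γ := by
  rw [sub_eq_add_neg, h.symmetric γ]
  exact h.subadditive φ (-γ)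

theorem restrict_mono (h : IsNaturalRank rank) (φ : PolMap F d k) {I J : Set ℕ} (hIJ : I ⊆ J) :
    rank (restrict φ I) ≤ rank (restrict φ J) := by
  rw [← Set.inter_eq_self_of_subset_right hIJ, ← restrict_restrict]
  exact h.monotone _ _

open Classical in
/-- Inclusion–exclusion for ranks. The map `ψ` is the product over `i ∈ S` of the operators
`id - restrict · (B i)`, applied to `φ`: it consists of the monomials of `φ` that are supported in
none of the sets `B i`. -/
theorem exists_le_add_sum_restrict (h : IsNaturalRank rank) {ι : Type*} (B : ι → Set ℕ)
    (S : Finset ι) (φ : PolMap F d k) :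
    ∃ ψ : PolMap F d k,
      rank φ ≤ rank ψ + 2 ^ #S * ∑ i ∈ S, rank (restrict φ (B i)) ∧
      ∀ j m, (ψ.1 j).coeff m =
        if ∃ i ∈ S, (m.support : Set ℕ) ⊆ B i then 0 else (φ.1 j).coeff m := by
  induction S using Finset.induction_on generalizing φ with
  | empty => exact ⟨φ, by simp, by simp⟩
  | insert a S ha ih =>
    obtain ⟨ψ, hψ, hcoeff⟩ := ih (φ - restrict φ (B a))
    refine ⟨ψ, ?_, fun j m => ?_⟩
    · have h1 : rank φ ≤ rank (φ - restrict φ (B a)) + rank (restrict φ (B a)) := by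
        simpa using h.subadditive (φ - restrict φ (B a)) (restrict φ (B a))
      have h2 : ∑ i ∈ S, rank (restrict (φ - restrict φ (B a)) (B i)) ≤
          2 * ∑ i ∈ S, rank (restrict φ (B i)) := by
        rw [Finset.mul_sum]
        refine Finset.sum_le_sum fun i _ => ?_
        rw [restrict_sub, restrict_restrict, two_mul]
        exact (h.sub_le _ _).trans (by gcongr; exact h.restrict_mono φ Set.inter_subset_right)
      have h3 : (1 : ℝ≥0) ≤ 2 ^ (#S + 1) := one_le_pow₀ (by norm_num)
      rw [Finset.card_insert_of_notMem ha, Finset.sum_insert ha]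
      calc rank φ ≤ rank ψ + 2 ^ #S * (2 * ∑ i ∈ S, rank (restrict φ (B i))) +
            1 * rank (restrict φ (B a)) := by
            rw [one_mul]
            exact h1.trans (by gcongr; exact hψ.trans (by gcongr))
        _ ≤ rank ψ + 2 ^ #S * (2 * ∑ i ∈ S, rank (restrict φ (B i))) +
            2 ^ (#S + 1) * rank (restrict φ (B a)) := by gcongr
        _ = _ := by ring
    · have hsub : ((φ - restrict φ (B a)).1 j).coeff m =
          (φ.1 j).coeff m - ((restrict φ (B a)).1 j).coeff m :=
        MvPolynomial.coeff_sub ..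
      rw [hcoeff, hsub, coeff_restrict]
      simp only [Finset.exists_mem_insert]
      by_cases hBa : (m.support : Set ℕ) ⊆ B a <;> simp [hBa]

theorem restrict_le_sum_of_coloring (h : IsNaturalRank rank) (φ : PolMap F d k) (t : Finset ℕ)
    (χ : ℕ → Fin (d + 1)) :
    rank (restrict φ t) ≤
      2 ^ (d + 1) * ∑ i, rank (restrict φ (t.filter fun x => χ x ≠ i : Finset ℕ)) := by
  classical
  obtain ⟨ψ, hψ, hcoeff⟩ := h.exists_le_add_sum_restrict (fun i => {x | χ x ≠ i}) Finset.univ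
    (restrict φ t)
  have hψ₀ : ψ = 0 := ext_coeff fun j m => by
    rw [hcoeff]
    split_ifs with hm
    · exact (MvPolynomial.coeff_zero m).symm
    · by_contra hne
      obtain ⟨i, hi⟩ := exists_support_subset_of_coeff_ne_zero _ hne χ
      exact hm ⟨i, Finset.mem_univ i, hi⟩
  rw [hψ₀, h.map_zero, zero_add, Finset.card_univ, Fintype.card_fin] at hψ
  refine hψ.trans_eq ?_
  congr 1
  refine Finset.sum_congr rfl fun i _ => ?_
  rw [restrict_restrict]
  congr 2
  ext x
  simp

/-- A random restriction of density `d / (d + 1)` costs at most a constant factor on average. -/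
theorem restrict_le_mul_subsetAvg (h : IsNaturalRank rank) (φ : PolMap F d k) (t : Finset ℕ) :
    (rank (restrict φ t) : ℝ) ≤ 2 ^ (d + 1) * (d + 1) *
      subsetAvg (1 - 1 / (d + 1)) t fun u => (rank (restrict φ u) : ℝ) := by
  have h1 := le_sum_subsetAvg_of_forall_coloring (ι := Fin (d + 1)) t (rank (restrict φ t) : ℝ)
    (fun _ u => 2 ^ (d + 1) * (rank (restrict φ u) : ℝ)) fun χ => by
      rw [← Finset.mul_sum]
      exact_mod_cast h.restrict_le_sum_of_coloring φ t χ
  simp only [subsetAvg_const_mul, Finset.sum_const, Finset.card_univ, Fintype.card_fin,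
    nsmul_eq_mul, Nat.cast_add, Nat.cast_one] at h1
  linarith

end IsNaturalRank

/-- `setBer(Set.Iio n, σ)` is the law of the random subset of `{0, …, n-1}` that contains each
element independently with probability `σ`. -/
theorem theorem1p5 (d : ℕ) (σ : ℝ) (hσ₀ : 0 < σ) (hσ₁ : σ ≤ 1) :
    ∃ κ : ℝ, 0 < κ ∧ ∀ ε : ℝ, 0 < ε → ε ≤ 1 → ∃ R : ℕ,
      ∀ (F : Type u) [Field F] (k : ℕ) (rank : PolMap F d k → ℝ≥0), IsNaturalRank rank →
        ∀ (n : ℕ) (φ : PolMap F d k), PolMap.InVars n φ → (R : ℝ) ≤ rank φ →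
          1 - ε ≤ (setBernoulli (Set.Iio n) (⟨σ, hσ₀.le, hσ₁⟩ : unitInterval)).real
            {I : Set ℕ | κ * (rank φ : ℝ) ≤ rank (PolMap.restrict φ I)} := by
  classical
  set q : ℝ := 1 - 1 / (d + 1)
  have hd : (0 : ℝ) < 1 / (d + 1) := by positivity
  have hd₁ : 1 / ((d : ℝ) + 1) ≤ 1 := div_le_one_of_le₀ (by simp) (by positivity)
  have hq₀ : 0 ≤ q := by linarith
  have hq₁ : q < 1 := by linarith
  obtain ⟨j, hj⟩ := exists_pow_lt_of_lt_one hσ₀ hq₁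
  set C : ℝ := (2 ^ (d + 1) * (d + 1)) ^ j
  have hC₀ : 0 < C := by positivity
  set c : ℝ := 1 / (2 * C) with hc
  have hc₀ : 0 < c := by positivity
  refine ⟨c / 2, by positivity, fun ε hε _ => ?_⟩
  refine ⟨⌈4 / (ε ^ 2 * c ^ 2 * (σ - q ^ j))⌉₊ + 1, fun F _ k rank hrank n φ hφ hR => ?_⟩
  push_cast at hR
  have hceil := Nat.le_ceil (4 / (ε ^ 2 * c ^ 2 * (σ - q ^ j)))
  set f : Finset ℕ → ℝ := fun t => (rank (PolMap.restrict φ t) : ℝ) with hf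
  have hs : f (Finset.range n) = rank φ := by
    simp only [hf, Finset.coe_range, hφ.restrict_eq]
  have hmean : 2 * c * f (Finset.range n) ≤ subsetAvg (q ^ j) (Finset.range n) f := by
    have h1 := le_pow_mul_subsetAvg_pow hq₀ hq₁.le (by positivity)
      (hrank.restrict_le_mul_subsetAvg φ) j (Finset.range n)
    have h2 : 2 * c = C⁻¹ := by rw [hc]; field_simp
    rw [h2, ← div_eq_inv_mul, div_le_iff₀' hC₀]
    exact h1
  have hconc := one_sub_le_subsetAvg_of_mean_le (pow_nonneg hq₀ j) hj hσ₁ hc₀ hε (Finset.range n)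
    (f := f) (fun t u htu => NNReal.coe_le_coe.2 (hrank.restrict_mono φ (Finset.coe_subset.2 htu)))
    (fun t => NNReal.coe_nonneg _)
    (fun a t => by
      have h1 := hrank.lipschitz φ t {a}
      rw [Finset.card_singleton, Finset.coe_singleton, Set.union_singleton,
        ← Finset.coe_insert] at h1
      exact_mod_cast h1)
    hmean (by rw [hs]; linarith [Nat.cast_nonneg (α := ℝ) ⌈4 / (ε ^ 2 * c ^ 2 * (σ - q ^ j))⌉₊])
    (by rw [hs]; linarith)
  rw [← Finset.coe_range, setBernoulli_real_eq_subsetAvg]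
  rw [hs] at hconc
  simpa only [Set.mem_ofPred_eq] using hconc
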